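/- For nonnegative integers $k_{-1},k_0,k_1$ with $k_{-1}+k_0+k_1=n$ and an integer $t$, let $V_n(k_{-1},k_0,k_1)$ be the set of vectors in $\{-1,0,1\}^n$ having exactly $k_{-1}$ coordinates equal to $-1$, $k_0$ coordinates equal to $0$ and $k_1$ coordinates equal to $1$. Let $G_n(k_{-1},k_0,k_1,t)$ be the graph on this vertex set in which two distinct vectors are adjacent if and only if their scalar product equals $t$, and let $m(n,k_{-1},k_0,k_1,t)$ be its independence number. Write $C_a^b=\binom ab$. Assume that $k_1\le \frac{n-k_{-1}}2$, that $k_{-1}\le t$, and that $q=k_1+k_{-1}-t$ is a prime power. (1) If $2(t-k_{-1})<k_1$, then $$m(n,k_{-1},k_0,k_1,t)\le C_n^{k_{-1}}\sum_{i=0}^{q-1}C_{k_1+k_0}^i .$$ (2) If $2(t-k_{-1})\ge k_1$, put $d=2(t-k_{-1})-k_1+1$. Let $d_1,d_2\ge 0$ be integers with $d_1+d_2=d$, and put $n_1=(n-k_{-1})-d_1$, $k_2=k_1-d_1$. Let $r\ge 0$ be an integer such that $$(k_2-d_2+1)\left(2+\frac{d_2-1}{r+1}\right)\le n_1<(k_2-d_2+1)\left(2+\frac{d_2-1}{r}\right),$$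 where for $r=0$ only the left inequality is required. Then $$m(n,k_{-1},k_0,k_1,t)\le C_n^{k_{-1}}\,\frac{C_{n_1}^{d_2+2r}\,C_{n-k_{-1}}^{d_1}}{C_{k_2}^{d_2+r}\,C_{n_1-k_2}^{r}\,C_{k_1}^{d_1}}\left(\sum_{i=0}^{q-1}C_{n_1}^i\right).$$ -/

import Mathlib

/-- The vertex set `V_n(k₋₁, k₀, k₁)`: vectors of length `n` with entries in `{-1, 0, 1}`, exactly
`km` of them equal to `-1`, `k0` equal to `0` and `k1` equal to `1`. -/
def signVectors (n km k0 k1 : ℕ) : Set (Fin n → ℤ) :=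
  {x | (∀ i, x i = -1 ∨ x i = 0 ∨ x i = 1) ∧
    (Finset.univ.filter (fun i => x i = -1)).card = km ∧
    (Finset.univ.filter (fun i => x i = 0)).card = k0 ∧
    (Finset.univ.filter (fun i => x i = 1)).card = k1}

/-- The graph `G_n(k₋₁, k₀, k₁, t)`: two distinct vertices are adjacent when their scalar product
is `t`. -/
def signGraph (n km k0 k1 : ℕ) (t : ℤ) : SimpleGraph (signVectors n km k0 k1) where
  Adj x y := x ≠ y ∧ dotProduct x.1 y.1 = t
  symm := ⟨fun x y h => ⟨h.1.symm, by rw [dotProduct_comm]; exact h.2⟩⟩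
  loopless := ⟨fun _ h => h.1 rfl⟩

/-- The vertex set is finite, so the supremum in `SimpleGraph.indepNum` is a true maximum. -/
theorem finite_signVectors (n km k0 k1 : ℕ) : (signVectors n km k0 k1).Finite := by
  refine (Set.Finite.pi' (t := fun _ : Fin n => ({-1, 0, 1} : Set ℤ))
    (fun _ => by simp)).subset ?_
  intro x hx i
  simpa using hx.1 i

/-- `m(n, k₋₁, k₀, k₁, t)`, the independence number of `G_n(k₋₁, k₀, k₁, t)`. -/
noncomputable def signIndepNum (n km k0 k1 : ℕ) (t : ℤ) : ℕ :=
  (signGraph n km k0 k1 t).indepNum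

/-!
The coordinates equal to `-1` are disposed of by the pigeonhole principle: the vectors of an
independent set with a prescribed set `M` of `-1`s correspond to `k₁`-subsets of the complement of
`M`, which has `n - k₋₁` elements, and the scalar product of two of them is `k₋₁` plus the size of
the intersection of the subsets. So it suffices to bound, in an `N`-set with `N = n - k₋₁`, a family
of `k`-subsets no two of which meet in exactly `s = t - k₋₁` elements, where `q = k - s` is a prime
power (`indepNum_mul_le_of_avoiding`).

If any two members meet in more than `k - 2q` elements, then `s` is the only intersection size
congruent to `k` modulo `q`, and the modular Frankl–Wilson bound `∑_{i < q} C(N, i)` applies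
(`card_le_sum_choose_of_prime_pow`). It is proved by a rank argument: with `q = p ^ a`, the matrix of
the `C(|A ∩ B| + c, q - 1)` modulo `p` is diagonal and invertible for a suitable shift `c`, because
`p` divides `C(x, q - 1)` unless `q ∣ x + 1`; on the other hand it factors through the subsets with
fewer than `q` elements. If `2s < k`, the condition on the intersections is automatic.

Otherwise the intersections are made large by double counting. A fixed `d₁`-set `D` is contained in a
large part of the family for a suitable `D` (`Avoiding.card_mul_le_contain`). Deleting `D`, one finds
a `(d₂ + 2r)`-set `T` meeting a large part of what remains in exactly `d₂ + r` elements
(`Avoiding.card_mul_le_trace`); any two of these members share at least `d₂` elements of `T`. The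
value `d₁ + d₂ = 2s - k + 1` is just what the Frankl–Wilson bound needs. The inequalities on `r` in
the statement serve only to make the binomial coefficients in the denominator positive.
-/

/-! ### Binomial coefficients modulo a prime -/

/-- By Lucas' theorem, the binomial coefficient `C(x, p ^ a - 1)` detects divisibility of `x + 1` by
the prime power `p ^ a`. -/
theorem prime_dvd_choose_pow_sub_one_iff {p : ℕ} (hp : p.Prime) (a x : ℕ) :
    p ∣ x.choose (p ^ a - 1) ↔ ¬ p ^ a ∣ x + 1 := by
  have := Fact.mk hp
  induction a generalizing x with
  | zero => simpa using hp.one_lt.ne'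
  | succ a ih =>
    have hp0 := hp.pos
    have hpa : 0 < p ^ a := pow_pos hp0 a
    have hk : p ^ (a + 1) - 1 = (p - 1) + p * (p ^ a - 1) := by
      obtain ⟨b, hb⟩ : ∃ b, p ^ a = b + 1 := ⟨p ^ a - 1, by omega⟩
      obtain ⟨c, rfl⟩ : ∃ c, p = c + 1 := ⟨p - 1, by omega⟩
      rw [pow_succ, hb]
      simp only [Nat.add_sub_cancel]
      have : (b + 1) * (c + 1) = c + (c + 1) * b + 1 := by ring
      omega
    have hmod : (p ^ (a + 1) - 1) % p = p - 1 := by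
      rw [hk, Nat.add_mul_mod_self_left, Nat.mod_eq_of_lt (by omega)]
    have hdiv : (p ^ (a + 1) - 1) / p = p ^ a - 1 := by
      rw [hk, Nat.add_mul_div_left _ _ hp0, Nat.div_eq_of_lt (by omega), zero_add]
    have hlucas := Choose.choose_modEq_choose_mod_mul_choose_div_nat (n := x)
      (k := p ^ (a + 1) - 1) (p := p)
    rw [hmod, hdiv] at hlucas
    rw [hlucas.dvd_iff dvd_rfl]
    have hx := Nat.mod_add_div x p
    have hlt := Nat.mod_lt x hp0
    by_cases h : x % p = p - 1
    · have hx1 : x + 1 = p * (x / p + 1) := by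
        rw [mul_add, mul_one]; omega
      rw [h, Nat.choose_self, one_mul, hx1, pow_succ', Nat.mul_dvd_mul_iff_left hp0]
      exact ih (x / p)
    · rw [Nat.choose_eq_zero_of_lt (by omega), zero_mul]
      refine iff_of_true (dvd_zero p) fun hdvd => h ?_
      have h1 : p ∣ x % p + 1 := by
        have h2 : p ∣ x + 1 := (dvd_pow_self p a.succ_ne_zero).trans hdvd
        rw [← hx, add_right_comm] at h2
        exact (Nat.dvd_add_left (dvd_mul_right p _)).1 h2
      have := Nat.le_of_dvd (Nat.succ_pos _) h1
      omega

/-! ### The modular Frankl–Wilson bound -/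

/-- Expansion of a shifted binomial coefficient of an intersection size over the small subsets of the
ground set; it exhibits the intersection matrix as a product through these subsets. -/
theorem choose_card_inter_add {α : Type*} [DecidableEq α] {X A B : Finset α} (hA : A ⊆ X)
    (c : ℕ) {q : ℕ} (hq : 0 < q) :
    ((A ∩ B).card + c).choose (q - 1) =
      ∑ S ∈ (Finset.range q).sigma fun i => X.powersetCard i,
        (if S.2 ⊆ A then 1 else 0) * (c.choose (q - 1 - S.1) * if S.2 ⊆ B then 1 else 0) := by
  rw [Nat.add_choose_eq, Finset.Nat.sum_antidiagonal_eq_sum_range_succ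
    (fun i j => (A ∩ B).card.choose i * c.choose j), Nat.succ_eq_add_one, Nat.sub_add_cancel hq,
    Finset.sum_sigma]
  refine Finset.sum_congr rfl fun i _ => ?_
  have hS : (A ∩ B).powersetCard i = (X.powersetCard i).filter fun S => S ⊆ A ∧ S ⊆ B := by
    ext S
    simp only [Finset.mem_powersetCard, Finset.mem_filter, Finset.subset_inter_iff]
    constructor
    · rintro ⟨⟨h1, h2⟩, h3⟩
      exact ⟨⟨h1.trans hA, h3⟩, h1, h2⟩
    · rintro ⟨⟨_, h3⟩, h⟩
      exact ⟨h, h3⟩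
  rw [← Finset.card_powersetCard, hS, Finset.card_filter, Finset.sum_mul]
  refine Finset.sum_congr rfl fun S _ => ?_
  by_cases h1 : S ⊆ A <;> by_cases h2 : S ⊆ B <;> simp [h1, h2]

/-- The **Frankl–Wilson bound** modulo a prime power `q`, for an indexed family of subsets of `X`. -/
theorem card_le_sum_choose_of_prime_pow {α ι : Type*} [DecidableEq α] {X : Finset α}
    {F : Finset ι} {f : ι → Finset α} {k q : ℕ} (hq : IsPrimePow q)
    (hsub : ∀ x ∈ F, f x ⊆ X) (hcard : ∀ x ∈ F, (f x).card = k)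
    (hne : ∀ x ∈ F, ∀ y ∈ F, x ≠ y → ¬ (f x ∩ f y).card ≡ k [MOD q]) :
    F.card ≤ ∑ i ∈ Finset.range q, X.card.choose i := by
  classical
  have hq0 : 0 < q := hq.pos
  obtain ⟨p, a, hp, -, hpa⟩ := (isPrimePow_nat_iff q).1 hq
  have := Fact.mk hp
  -- The shift `c` is chosen so that `k + c` is congruent to `-1` modulo `q`.
  set c := (q - 1) * (k + 1) with hc
  have hkc : k + c + 1 = q * (k + 1) := by
    obtain ⟨b, rfl⟩ : ∃ b, q = b + 1 := ⟨q - 1, by omega⟩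
    rw [hc, Nat.add_sub_cancel]; ring
  have hdvd : ∀ x : ℕ, q ∣ x + c + 1 ↔ x ≡ k [MOD q] := by
    intro x
    have h0 : k + (c + 1) ≡ 0 [MOD q] := by
      rw [← add_assoc, hkc]; exact (Nat.modEq_zero_iff_dvd).2 (dvd_mul_right _ _)
    rw [← Nat.modEq_zero_iff_dvd, add_assoc]
    exact ⟨fun h => Nat.ModEq.add_right_cancel' (c + 1) (h.trans h0.symm),
      fun h => (h.add_right (c + 1)).trans h0⟩
  have hentry : ∀ x : ℕ, ((x + c).choose (q - 1) : ZMod p) = 0 ↔ ¬ x ≡ k [MOD q] := by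
    intro x
    rw [ZMod.natCast_eq_zero_iff, ← hdvd, ← hpa]
    exact prime_dvd_choose_pow_sub_one_iff hp a (x + c)
  let I := (Finset.range q).sigma fun i => X.powersetCard i
  let P : Matrix F I (ZMod p) := Matrix.of fun x S => if S.1.2 ⊆ f x then 1 else 0
  let Q : Matrix I F (ZMod p) :=
    Matrix.of fun S y => (c.choose (q - 1 - S.1.1) : ZMod p) * if S.1.2 ⊆ f y then 1 else 0
  let w : F → ZMod p := fun x => ((f x ∩ f x).card + c).choose (q - 1)
  have hw : ∀ x, w x ≠ 0 := by
    intro x h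
    refine (hentry _).1 h ?_
    rw [Finset.inter_self, hcard x x.2]
  have hPQ : P * Q = Matrix.diagonal w := by
    ext x y
    have h1 : (P * Q) x y = (((f x ∩ f y).card + c).choose (q - 1) : ℕ) := by
      rw [choose_card_inter_add (hsub x x.2) c hq0, Matrix.mul_apply, Nat.cast_sum]
      refine Eq.trans ?_ (Finset.sum_coe_sort I _)
      refine Finset.sum_congr rfl fun S _ => ?_
      simp only [P, Q, Matrix.of_apply]
      push_cast
      rfl
    rw [h1]
    by_cases hxy : x = y
    · subst hxy; rw [Matrix.diagonal_apply_eq]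
    · rw [Matrix.diagonal_apply_ne _ hxy]
      exact (hentry _).2 (hne x x.2 y y.2 fun h => hxy (Subtype.ext h))
  have hunit : IsUnit (Matrix.diagonal w) := by
    rw [Matrix.isUnit_diagonal, Pi.isUnit_iff]
    exact fun x => (hw x).isUnit
  have hrank := (Matrix.rank_mul_le_left P Q).trans (Matrix.rank_le_card_width P)
  rw [hPQ, Matrix.rank_of_isUnit _ hunit, Fintype.card_coe, Fintype.card_coe] at hrank
  simpa [I, Finset.card_sigma, Finset.card_powersetCard] using hrank

/-! ### Families avoiding an intersection size -/

/-- The family `(f x)` indexed by `x ∈ F` consists of distinct `k`-element subsets of `X`, and members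
with different indices never meet in exactly `s` elements. -/
structure Avoiding {α ι : Type*} [DecidableEq α] (X : Finset α) (k s : ℕ) (F : Finset ι)
    (f : ι → Finset α) : Prop where
  subset : ∀ x ∈ F, f x ⊆ X
  card_eq : ∀ x ∈ F, (f x).card = k
  injOn : Set.InjOn f F
  card_inter_ne : ∀ x ∈ F, ∀ y ∈ F, x ≠ y → (f x ∩ f y).card ≠ s

namespace Avoiding

variable {α ι : Type*} [DecidableEq α] {X : Finset α} {k s q : ℕ} {F G : Finset ι}
  {f : ι → Finset α}

theorem mono (h : Avoiding X k s F f) (hG : G ⊆ F) : Avoiding X k s G f where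
  subset x hx := h.subset x (hG hx)
  card_eq x hx := h.card_eq x (hG hx)
  injOn := h.injOn.mono (Finset.coe_subset.2 hG)
  card_inter_ne x hx y hy := h.card_inter_ne x (hG hx) y (hG hy)

/-- If all intersections have more than `k - 2q` elements, then the avoided size `k - q` is the only
possible one congruent to `k` modulo `q`, as `k` itself would make two members equal. -/
theorem card_le_sum_choose (h : Avoiding X k s F f) (hq : IsPrimePow q) (hk : k = s + q)
    (hlarge : ∀ x ∈ F, ∀ y ∈ F, k < (f x ∩ f y).card + 2 * q) :
    F.card ≤ ∑ i ∈ Finset.range q, X.card.choose i := by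
  refine card_le_sum_choose_of_prime_pow hq h.subset h.card_eq fun x hx y hy hxy hmod => ?_
  have hle : (f x ∩ f y).card ≤ k := by
    rw [← h.card_eq x hx]; exact Finset.card_le_card Finset.inter_subset_left
  obtain ⟨m, hm⟩ := (Nat.modEq_iff_dvd' hle).1 hmod
  have hl := hlarge x hx y hy
  have hm2 : m < 2 := by
    by_contra hcon
    have : q * 2 ≤ q * m := Nat.mul_le_mul_left q (by omega)
    omega
  interval_cases m
  · have hkc : k ≤ (f x ∩ f y).card := by omega
    have h1 : f x ∩ f y = f x :=
      Finset.eq_of_subset_of_card_le Finset.inter_subset_left (by rw [h.card_eq x hx]; exact hkc)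
    have h2 : f x ∩ f y = f y :=
      Finset.eq_of_subset_of_card_le Finset.inter_subset_right (by rw [h.card_eq y hy]; exact hkc)
    exact hxy (h.injOn hx hy (h1.symm.trans h2))
  · exact h.card_inter_ne x hx y hy hxy (by omega)

end Avoiding

/-! ### Enlarging the intersections by double counting -/

/-- Lower bound for the number of sets `T` with `|A ∩ T| = u` and `|T \ A| = v`. -/
theorem choose_mul_choose_le_card_filter {α : Type*} [DecidableEq α] {X A : Finset α} (hA : A ⊆ X)
    (u v : ℕ) :
    A.card.choose u * (X.card - A.card).choose v ≤
      ((X.powersetCard (u + v)).filter fun T => (A ∩ T).card = u).card := by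
  rw [← Finset.card_sdiff_of_subset hA, ← Finset.card_powersetCard, ← Finset.card_powersetCard,
    ← Finset.card_product]
  have hU : ∀ U V : Finset α, U ⊆ A → V ⊆ X \ A → A ∩ (U ∪ V) = U := by
    intro U V hU hV
    rw [Finset.inter_union_distrib_left, Finset.inter_eq_right.2 hU,
      Finset.disjoint_iff_inter_eq_empty.1 (Finset.disjoint_sdiff.mono_right hV), Finset.union_empty]
  have hV : ∀ U V : Finset α, U ⊆ A → V ⊆ X \ A → (U ∪ V) \ A = V := by
    intro U V hU hV
    rw [Finset.union_sdiff_distrib, Finset.sdiff_eq_empty_iff_subset.2 hU, Finset.empty_union,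
      Finset.sdiff_eq_self_of_disjoint (Finset.disjoint_sdiff.mono_right hV).symm]
  refine Finset.card_le_card_of_injOn (fun P => P.1 ∪ P.2) ?_ ?_
  · rintro ⟨U, V⟩ h
    simp only [Finset.coe_product, Set.mem_prod, Finset.mem_coe, Finset.mem_powersetCard] at h
    obtain ⟨⟨hUA, hUc⟩, hVX, hVc⟩ := h
    simp only [Finset.mem_coe, Finset.mem_filter, Finset.mem_powersetCard]
    refine ⟨⟨Finset.union_subset (hUA.trans hA) (hVX.trans Finset.sdiff_subset), ?_⟩, ?_⟩
    · rw [Finset.card_union_of_disjoint (Finset.disjoint_sdiff.mono hUA hVX), hUc, hVc]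
    · rw [hU U V hUA hVX, hUc]
  · rintro ⟨U, V⟩ h ⟨U', V'⟩ h' heq
    simp only [Finset.coe_product, Set.mem_prod, Finset.mem_coe, Finset.mem_powersetCard] at h h'
    dsimp only at heq
    have h1 := hU U V h.1.1 h.2.1
    have h2 := hV U V h.1.1 h.2.1
    rw [heq] at h1 h2
    exact Prod.ext (h1.symm.trans (hU U' V' h'.1.1 h'.2.1))
      (h2.symm.trans (hV U' V' h'.1.1 h'.2.1))

namespace Avoiding

variable {α ι : Type*} [DecidableEq α] {X : Finset α} {k s q : ℕ} {F : Finset ι}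
  {f : ι → Finset α}

/-- Two members that meet an `(e + 2r)`-set `T` in `e + r` elements each have at least `e` elements of
`T` in common. -/
theorem card_mul_le_trace (h : Avoiding X k s F f) (hq : IsPrimePow q) (hk : k = s + q)
    (e r : ℕ) (he : k < e + 2 * q) :
    F.card * (k.choose (e + r) * (X.card - k).choose r) ≤
      X.card.choose (e + 2 * r) * ∑ i ∈ Finset.range q, X.card.choose i := by
  classical
  rw [← Finset.card_powersetCard (e + 2 * r) X]
  refine Finset.card_mul_le_card_mul (fun x T => (f x ∩ T).card = e + r) (fun x hx => ?_)
    fun T hT => ?_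
  · have := choose_mul_choose_le_card_filter (h.subset x hx) (e + r) r
    rw [h.card_eq x hx, show e + r + r = e + 2 * r by ring] at this
    exact this
  · have hsub : F.bipartiteBelow (fun x T => (f x ∩ T).card = e + r) T ⊆ F :=
      Finset.filter_subset _ _
    refine (h.mono hsub).card_le_sum_choose hq hk fun x hx y hy => ?_
    have hx' := (Finset.mem_bipartiteBelow _).1 hx |>.2
    have hy' := (Finset.mem_bipartiteBelow _).1 hy |>.2
    have hTc := (Finset.mem_powersetCard.1 hT).2
    have h1 := Finset.card_union_add_card_inter (f x ∩ T) (f y ∩ T)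
    have h2 : (f x ∩ T ∪ f y ∩ T).card ≤ T.card :=
      Finset.card_le_card (Finset.union_subset Finset.inter_subset_right Finset.inter_subset_right)
    have h3 : ((f x ∩ T) ∩ (f y ∩ T)).card ≤ (f x ∩ f y).card :=
      Finset.card_le_card (Finset.inter_subset_inter Finset.inter_subset_left
        Finset.inter_subset_left)
    omega

/-- The members containing a `d`-set `D` are replaced by their differences with `D`, which lowers all
intersection sizes by `d`. -/
theorem card_mul_le_contain {N l : ℕ} (h : Avoiding X k s F f) (hq : IsPrimePow q)
    (hk : k = s + q) (d e r : ℕ) (hN : N + d = X.card) (hl : l + d = k)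
    (hd : d ≤ s) (he : l < e + 2 * q) :
    F.card * k.choose d * (l.choose (e + r) * (N - l).choose r) ≤
      X.card.choose d * (N.choose (e + 2 * r) * ∑ i ∈ Finset.range q, N.choose i) := by
  classical
  set C := l.choose (e + r) * (N - l).choose r
  set B := N.choose (e + 2 * r) * ∑ i ∈ Finset.range q, N.choose i
  rcases Nat.eq_zero_or_pos C with hC | hC
  · simp [hC]
  -- The link of each `D` has at most `B / C` members; as sizes are integers, rounding is harmless.
  suffices hdc : F.card * k.choose d ≤ X.card.choose d * (B / C) by
    calc F.card * k.choose d * C ≤ X.card.choose d * (B / C) * C := Nat.mul_le_mul_right C hdc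
      _ = X.card.choose d * (B / C * C) := mul_assoc _ _ _
      _ ≤ X.card.choose d * B := Nat.mul_le_mul_left _ (Nat.div_mul_le_self B C)
  rw [← Finset.card_powersetCard d X]
  refine Finset.card_mul_le_card_mul (fun x D => D ⊆ f x) (fun x hx => ?_) fun D hD => ?_
  · rw [← h.card_eq x hx, ← Finset.card_powersetCard]
    refine Finset.card_le_card fun D hD => ?_
    obtain ⟨hDx, hDc⟩ := Finset.mem_powersetCard.1 hD
    exact (Finset.mem_bipartiteAbove _).2
      ⟨Finset.mem_powersetCard.2 ⟨hDx.trans (h.subset x hx), hDc⟩, hDx⟩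
  · obtain ⟨hDX, hDc⟩ := Finset.mem_powersetCard.1 hD
    have hmem : ∀ x ∈ F.bipartiteBelow (fun x D => D ⊆ f x) D, x ∈ F ∧ D ⊆ f x :=
      fun x hx => (Finset.mem_bipartiteBelow _).1 hx
    have hlink : Avoiding (X \ D) l (s - d) (F.bipartiteBelow (fun x D => D ⊆ f x) D)
        (fun x => f x \ D) :=
      { subset := fun x hx => Finset.sdiff_subset_sdiff (h.subset x (hmem x hx).1) le_rfl
        card_eq := fun x hx => by
          rw [Finset.card_sdiff_of_subset (hmem x hx).2, h.card_eq x (hmem x hx).1, hDc]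
          omega
        injOn := fun x hx y hy hxy => by
          refine h.injOn (hmem x hx).1 (hmem y hy).1 ?_
          have := congrArg (· ∪ D) hxy
          simpa only [Finset.sdiff_union_of_subset (hmem x hx).2,
            Finset.sdiff_union_of_subset (hmem y hy).2] using this
        card_inter_ne := fun x hx y hy hxy heq => by
          refine h.card_inter_ne x (hmem x hx).1 y (hmem y hy).1 hxy ?_
          have hDxy : D ⊆ f x ∩ f y := Finset.subset_inter (hmem x hx).2 (hmem y hy).2
          have h1 : (f x \ D) ∩ (f y \ D) = (f x ∩ f y) \ D := by
            ext a; simp only [Finset.mem_inter, Finset.mem_sdiff]; tauto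
          rw [h1, Finset.card_sdiff_of_subset hDxy, hDc] at heq
          have := Finset.card_le_card hDxy
          omega }
    have hXD : (X \ D).card = N := by
      rw [Finset.card_sdiff_of_subset hDX, hDc]; omega
    have := hlink.card_mul_le_trace hq (by omega) e r he
    rw [hXD] at this
    exact (Nat.le_div_iff_mul_le hC).2 this

end Avoiding

/-! ### From sign vectors to set families -/

/-- The scalar product of two vectors with entries in `{-1, 0, 1}` that have the same `-1`s. -/
theorem dotProduct_eq_of_neg_eq {n : ℕ} {x y : Fin n → ℤ} {M : Finset (Fin n)}
    (hx : ∀ i, x i = -1 ∨ x i = 0 ∨ x i = 1) (hy : ∀ i, y i = -1 ∨ y i = 0 ∨ y i = 1)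
    (hxM : Finset.univ.filter (fun i => x i = -1) = M)
    (hyM : Finset.univ.filter (fun i => y i = -1) = M) :
    dotProduct x y = M.card +
      (Finset.univ.filter (fun i => x i = 1) ∩ Finset.univ.filter (fun i => y i = 1)).card := by
  rw [← hxM, ← Finset.filter_and, Finset.card_filter, Finset.card_filter]
  push_cast
  rw [← Finset.sum_add_distrib]
  refine Finset.sum_congr rfl fun i _ => ?_
  have hi : x i = -1 ↔ y i = -1 := by
    have := Finset.ext_iff.1 (hxM.trans hyM.symm) i
    simpa using this
  rcases hx i with h1 | h1 | h1 <;> rcases hy i with h2 | h2 | h2 <;> simp_all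

/-- Pigeonhole over the position of the `-1`s: a bound for all families of `k1`-subsets of an
`(n - km)`-set that avoid the intersection size `s` bounds the independence number. -/
theorem indepNum_mul_le_of_avoiding {n km k0 k1 s C B : ℕ} {t : ℤ} (ht : t = km + s)
    (hbound : ∀ (X : Finset (Fin n)) (F : Finset (signVectors n km k0 k1))
      (f : signVectors n km k0 k1 → Finset (Fin n)), X.card = n - km →
      Avoiding X k1 s F f → F.card * C ≤ B) :
    signIndepNum n km k0 k1 t * C ≤ n.choose km * B := by
  classical
  have := (finite_signVectors n km k0 k1).to_subtype
  have := Fintype.ofFinite (signVectors n km k0 k1)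
  obtain ⟨W, hW⟩ := (signGraph n km k0 k1 t).exists_isNIndepSet_indepNum
  rw [signIndepNum, ← hW.card_eq]
  rcases Nat.eq_zero_or_pos C with hC | hC
  · simp [hC]
  let neg : signVectors n km k0 k1 → Finset (Fin n) :=
    fun x => Finset.univ.filter fun i => x.1 i = -1
  let pos : signVectors n km k0 k1 → Finset (Fin n) :=
    fun x => Finset.univ.filter fun i => x.1 i = 1
  have hneg : ∀ x ∈ W, neg x ∈ Finset.univ.powersetCard km := fun x _ =>
    Finset.mem_powersetCard.2 ⟨Finset.subset_univ _, x.2.2.1⟩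
  have hfib : W.card ≤ B / C * (Finset.univ.powersetCard km : Finset (Finset (Fin n))).card := by
    refine Finset.card_le_mul_card_image_of_maps_to hneg _ fun M hM => ?_
    have hMc := (Finset.mem_powersetCard.1 hM).2
    rw [Nat.le_div_iff_mul_le hC]
    refine hbound (Finset.univ \ M) _ pos ?_ ?_
    · rw [Finset.card_sdiff_of_subset (Finset.subset_univ M), hMc, Finset.card_fin]
    have hmem : ∀ x ∈ W.filter fun x => neg x = M, x ∈ W ∧ neg x = M :=
      fun x hx => Finset.mem_filter.1 hx
    exact
      { subset := fun x hx i hi => by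
          have hi1 : x.1 i = 1 := by simpa [pos] using hi
          rw [← (hmem x hx).2]
          simp [neg, hi1]
        card_eq := fun x _ => x.2.2.2.2
        injOn := fun x hx y hy hxy => by
          have hn := (hmem x hx).2.trans (hmem y hy).2.symm
          refine Subtype.ext (funext fun i => ?_)
          have h1 : x.1 i = 1 ↔ y.1 i = 1 := by
            simpa [pos] using Finset.ext_iff.1 hxy i
          have h2 : x.1 i = -1 ↔ y.1 i = -1 := by
            simpa [neg] using Finset.ext_iff.1 hn i
          rcases x.2.1 i with h | h | h <;> rcases y.2.1 i with h' | h' | h' <;> simp_all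
        card_inter_ne := fun x hx y hy hxy heq => by
          refine hW.isIndepSet (hmem x hx).1 (hmem y hy).1 hxy ⟨hxy, ?_⟩
          rw [dotProduct_eq_of_neg_eq x.2.1 y.2.1 (hmem x hx).2 (hmem y hy).2, hMc, ht]
          simpa [pos] using heq }
  rw [Finset.card_powersetCard, Finset.card_fin] at hfib
  calc W.card * C ≤ B / C * n.choose km * C := Nat.mul_le_mul_right C hfib
    _ = n.choose km * (B / C * C) := by ring
    _ ≤ n.choose km * B := Nat.mul_le_mul_left _ (Nat.div_mul_le_self B C)

/-! ### The range of the parameter `r` -/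

/-- The inequalities that determine `r`, with `k₂ - d₂ + 1 = 2q` inserted, force `r ≤ q`
when `n₁ ≥ 2(2q + d₂ - 1)`, which follows from `k₁ ≤ (n - k₋₁) / 2`. For `d₂ ≤ 1` they allow only
`r = 0`, since the bounds then leave an empty interval. -/
theorem le_of_interval {q n₁ d₂ r : ℕ} (hn₁ : 2 * (2 * q + d₂) ≤ n₁ + 2)
    (hl : (2 * q : ℝ) * (2 + ((d₂ : ℝ) - 1) / ((r : ℝ) + 1)) ≤ n₁)
    (hu : 0 < r → (n₁ : ℝ) < 2 * q * (2 + ((d₂ : ℝ) - 1) / r)) : r ≤ q := by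
  rcases Nat.eq_zero_or_pos r with rfl | hr
  · exact Nat.zero_le q
  have hu := hu hr
  have hr' : (0 : ℝ) < r := by exact_mod_cast hr
  have hn' : 2 * (2 * (q : ℝ) + d₂) ≤ n₁ + 2 := by exact_mod_cast hn₁
  have hlt : (2 * q : ℝ) * (((d₂ : ℝ) - 1) / ((r : ℝ) + 1)) <
      2 * q * (((d₂ : ℝ) - 1) / r) := by linarith
  have hdiv : ((d₂ : ℝ) - 1) / ((r : ℝ) + 1) < ((d₂ : ℝ) - 1) / r :=
    lt_of_mul_lt_mul_left hlt (by positivity)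
  have hd : (0 : ℝ) < (d₂ : ℝ) - 1 := by
    rw [div_lt_div_iff₀ (by positivity) hr'] at hdiv
    linarith
  have h2 : 2 * ((d₂ : ℝ) - 1) * r < 2 * q * ((d₂ : ℝ) - 1) := by
    have h3 : 2 * ((d₂ : ℝ) - 1) < 2 * q * ((d₂ : ℝ) - 1) / r := by
      rw [mul_div_assoc]; linarith
    exact (lt_div_iff₀ hr').1 h3
  have h4 : (r : ℝ) < q := by
    refine lt_of_mul_lt_mul_left (a := 2 * ((d₂ : ℝ) - 1)) ?_ (by positivity)
    linarith
  exact_mod_cast h4.le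

/-! ### Bounds for the independence number -/

theorem mainTheorem5 (n km k0 k1 q : ℕ) (t : ℤ)
    (hn : km + k0 + k1 = n)
    (hk1 : (k1 : ℝ) ≤ ((n : ℝ) - km) / 2)
    (hkm : (km : ℤ) ≤ t)
    (hq : (q : ℤ) = k1 + km - t)
    (hpp : IsPrimePow q) :
    (2 * (t - km) < k1 →
      signIndepNum n km k0 k1 t
        ≤ n.choose km * ∑ i ∈ Finset.range q, (k1 + k0).choose i) ∧
    ((k1 : ℤ) ≤ 2 * (t - km) →
      ∀ d d₁ d₂ n₁ k₂ r : ℕ,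
        (d : ℤ) = 2 * (t - km) - k1 + 1 →
        d₁ + d₂ = d →
        (n₁ : ℤ) = ((n : ℤ) - km) - d₁ →
        (k₂ : ℤ) = (k1 : ℤ) - d₁ →
        ((k₂ : ℝ) - d₂ + 1) * (2 + ((d₂ : ℝ) - 1) / ((r : ℝ) + 1)) ≤ (n₁ : ℝ) →
        (0 < r → (n₁ : ℝ) < ((k₂ : ℝ) - d₂ + 1) * (2 + ((d₂ : ℝ) - 1) / (r : ℝ))) →
        (signIndepNum n km k0 k1 t : ℝ)
          ≤ (n.choose km : ℝ)
            * (((n₁.choose (d₂ + 2 * r) : ℝ) * ((n - km).choose d₁ : ℝ))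
                / ((k₂.choose (d₂ + r) : ℝ) * ((n₁ - k₂).choose r : ℝ) * (k1.choose d₁ : ℝ)))
            * (∑ i ∈ Finset.range q, (n₁.choose i : ℝ))) := by
  have hkn : 2 * k1 + km ≤ n := by
    have : 2 * (k1 : ℝ) + km ≤ n := by linarith
    exact_mod_cast this
  obtain ⟨s, hs⟩ := Int.eq_ofNat_of_zero_le (sub_nonneg.2 hkm)
  have ht : t = km + s := by omega
  have hk : k1 = s + q := by omega
  have hq0 := hpp.pos
  constructor
  · intro hsmall
    have h := indepNum_mul_le_of_avoiding (n := n) (k0 := k0) (k1 := k1) (C := 1)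
      (B := ∑ i ∈ Finset.range q, (k1 + k0).choose i) ht fun X F f hX h => by
        rw [mul_one, show k1 + k0 = X.card by omega]
        exact h.card_le_sum_choose hpp hk fun x _ y _ => by omega
    rwa [mul_one] at h
  · intro hlarge d d₁ d₂ n₁ k₂ r hd hd12 hn₁ hk₂ hl hu
    have h2q : (k₂ : ℝ) - d₂ + 1 = 2 * q := by
      have : k₂ + 1 = 2 * q + d₂ := by omega
      have : (k₂ : ℝ) + 1 = 2 * q + d₂ := by exact_mod_cast this
      linarith
    rw [h2q] at hl hu
    have hr : r ≤ q := le_of_interval (by omega) hl hu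
    have h := indepNum_mul_le_of_avoiding (n := n) (k0 := k0) (k1 := k1) ht fun X F f hX h => by
        have := h.card_mul_le_contain (N := n₁) (l := k₂) hpp hk d₁ d₂ r (by omega) (by omega)
          (by omega) (by omega)
        rw [hX, mul_assoc] at this
        exact this
    have hpos1 : 0 < k₂.choose (d₂ + r) := Nat.choose_pos (by omega)
    have hpos2 : 0 < (n₁ - k₂).choose r := Nat.choose_pos (by omega)
    have hpos3 : 0 < k1.choose d₁ := Nat.choose_pos (by omega)
    have hR : (signIndepNum n km k0 k1 t : ℝ) *
        ((k1.choose d₁ : ℝ) * ((k₂.choose (d₂ + r) : ℝ) * ((n₁ - k₂).choose r : ℝ))) ≤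
        n.choose km * ((n - km).choose d₁ * (n₁.choose (d₂ + 2 * r) *
          ∑ i ∈ Finset.range q, (n₁.choose i : ℝ))) := by
      exact_mod_cast h
    rw [mul_div_assoc', div_mul_eq_mul_div, le_div_iff₀ (by positivity)]
    linarith
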